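/- All logarithms, entropies and mutual informations are to base $2$. In a (deterministic) two-party protocol Alice holds $x\in\{0,1\}^n$ and Bob holds $y\in\{0,1\}^n$. The players exchange bits; who sends the next bit is determined by the bits exchanged so far, and its value is a function of the sender's input and of those bits. When the communication ends (which is also determined by the bits exchanged), Bob gives an answer that is a function of $y$ and of all the bits exchanged. The protocol computes $f:\{0,1\}^n\times\{0,1\}^n\to\{0,1\}$ exactly if Bob's answer is $f(x,y)$ for all $x,y$. Let $A$ and $B$ be the strings of bits received during the protocol by Alice and by Bob respectively, and let $|a|$ and $|b|$ be the numbers of bits received by Alice and by Bob (the maximum over all inputs, if the number depends on the inputs). When the input pair $(X,Y)$ is random, $I(Y:AX)=H(Y)-H(Y|AX)$ and $I(X:BY)=H(X)-H(X|BY)$, where $H$ is the Shannon entropy. \textbf{Lemma.} Let $f_n:\{0,1\}^n\times\{0,1\}^n\to\{0,1\}$ be picked uniformly at random. Then with probability $1-o(1)$ as $n\to\infty$, every protocol that computes $f_n$ exactly satisfies at least one of the following. \begin{enumerate} \item $|a|\ge n-\log(n+1)-2$, and there is a set $D\subseteq\{0,1\}^n\times\{0,1\}^n$ with $|D|\ge\frac12\cdot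 2^{2n}$ such that, for $(X,Y)$ uniformly distributed on $D$, $$I(Y:AX)\ge n-\log(n+1)-3.$$ \item $|b|\ge n-\log(n+1)-2$, and there is a set $D\subseteq\{0,1\}^n\times\{0,1\}^n$ with $|D|\ge\frac12\cdot 2^{2n}$ such that, for $(X,Y)$ uniformly distributed on $D$, $$I(X:BY)\ge n-\log(n+1)-3.$$ \end{enumerate} -/

import Mathlib

open Filter Topology

/-- `n`-bit strings. -/
abbrev BitString (n : ℕ) : Type := Fin n → Bool

/-- Deterministic two-party communication protocols: Alice holds an input in `X`, Bob holds an
input in `Y`, and at the end Bob announces a value in `Z`.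

A protocol is a finite binary tree. At an inner node the player who owns the node sends one bit
to the other player. The bit depends on the sender's input and, through the node reached, on all
the bits exchanged before. At a leaf, Bob's answer depends on his input and, through the leaf, on
all the bits exchanged. -/
inductive Protocol (X Y Z : Type) : Type where
  /-- The communication is over and Bob answers. -/
  | leaf (answer : Y → Z) : Protocol X Y Z
  /-- Alice sends the bit `message x` to Bob. -/
  | aliceSends (message : X → Bool) (next : Bool → Protocol X Y Z) : Protocol X Y Z
  /-- Bob sends the bit `message y` to Alice. -/
  | bobSends (message : Y → Bool) (next : Bool → Protocol X Y Z) : Protocol X Y Z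

namespace Protocol

variable {X Y Z : Type}

/-- Bob's answer on inputs `x`, `y`. -/
def output : Protocol X Y Z → X → Y → Z
  | leaf answer, _, y => answer y
  | aliceSends message next, x, y => (next (message x)).output x y
  | bobSends message next, x, y => (next (message y)).output x y

/-- The string `a` of all bits received by Alice on inputs `x`, `y`, in order. -/
def receivedByAlice : Protocol X Y Z → X → Y → List Bool
  | leaf _, _, _ => []
  | aliceSends message next, x, y => (next (message x)).receivedByAlice x y
  | bobSends message next, x, y => message y :: (next (message y)).receivedByAlice x y

/-- The string `b` of all bits received by Bob on inputs `x`, `y`, in order. -/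
def receivedByBob : Protocol X Y Z → X → Y → List Bool
  | leaf _, _, _ => []
  | aliceSends message next, x, y => message x :: (next (message x)).receivedByBob x y
  | bobSends message next, x, y => (next (message y)).receivedByBob x y

/-- The protocol computes `f` exactly: Bob's answer is `f x y` on every pair of inputs. -/
def Computes (π : Protocol X Y Z) (f : X → Y → Z) : Prop :=
  ∀ x y, π.output x y = f x y

/-- `|a|`: the number of bits received by Alice, in the worst case over the inputs. -/
def costAlice [Fintype X] [Fintype Y] (π : Protocol X Y Z) : ℕ :=
  Finset.univ.sup fun w : X × Y => (π.receivedByAlice w.1 w.2).length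

/-- `|b|`: the number of bits received by Bob, in the worst case over the inputs. -/
def costBob [Fintype X] [Fintype Y] (π : Protocol X Y Z) : ℕ :=
  Finset.univ.sup fun w : X × Y => (π.receivedByBob w.1 w.2).length

end Protocol

section Entropy

variable {Ω α β : Type} [Fintype Ω] [DecidableEq α] [DecidableEq β]

/-- The probability that the random variable `S` takes the value `s`, the sample point being
drawn from the distribution `p`. -/
noncomputable def probEq {Ω α : Type} (p : PMF Ω) (S : Ω → α) (s : α) : ℝ :=
  (p.map S s).toReal

/-- The Shannon entropy `H(S)`, in bits. (`0 * log 0 = 0` holds here.) -/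
noncomputable def shannonEntropy (p : PMF Ω) (S : Ω → α) : ℝ :=
  -∑ s ∈ Finset.univ.image S, probEq p S s * Real.logb 2 (probEq p S s)

/-- The conditional probability that `S = s` given `T = t` (only used with weight
`probEq p T t`, so that its value for `probEq p T t = 0` is irrelevant). -/
noncomputable def condProbEq {Ω α β : Type} (p : PMF Ω) (S : Ω → α) (T : Ω → β)
    (s : α) (t : β) : ℝ :=
  probEq p (fun w => (S w, T w)) (s, t) / probEq p T t

/-- The conditional entropy `H(S | T) = ∑ t, P(T = t) * H(S | T = t)`, in bits. -/
noncomputable def condShannonEntropy (p : PMF Ω) (S : Ω → α) (T : Ω → β) : ℝ :=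
  ∑ t ∈ Finset.univ.image T, probEq p T t *
    (-∑ s ∈ Finset.univ.image S, condProbEq p S T s t * Real.logb 2 (condProbEq p S T s t))

/-- The mutual information `I(S : T) = H(S) - H(S | T)`, in bits. -/
noncomputable def mutualInformation (p : PMF Ω) (S : Ω → α) (T : Ω → β) : ℝ :=
  shannonEntropy p S - condShannonEntropy p S T

end Entropy

/-- `I(Y : AX)` for the protocol `π`, when the input pair `(X, Y)` has distribution `p` and `A` is
the string of bits received by Alice. -/
noncomputable def infoAlice {n : ℕ} (π : Protocol (BitString n) (BitString n) Bool)
    (p : PMF (BitString n × BitString n)) : ℝ :=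
  mutualInformation p (fun w => w.2) (fun w => (π.receivedByAlice w.1 w.2, w.1))

/-- `I(X : BY)` for the protocol `π`, when the input pair `(X, Y)` has distribution `p` and `B` is
the string of bits received by Bob. -/
noncomputable def infoBob {n : ℕ} (π : Protocol (BitString n) (BitString n) Bool)
    (p : PMF (BitString n × BitString n)) : ℝ :=
  mutualInformation p (fun w => w.1) (fun w => (π.receivedByBob w.1 w.2, w.2))

/-! Fix an input pair `(x, y)`. Let `x'` range over the inputs giving Bob the same bits on `y`, and
`y'` over those giving Alice the same bits on `x`. All pairs `(x', y')` reach one leaf, where the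
answer depends on Bob's input alone, so on this rectangle `f` does not depend on the row
(`output_eq_of_received_eq`). By a union bound, all but a `2 ^ (-n)` fraction of functions have no
such rectangle of side `2 n + 3` (`ncard_hasColumnConstantRectangle_bitString_le`). Then one side
has at most `2 (n + 1)` elements at every pair, and for one of the players this happens on a set `D`
of at least half of all pairs (`half_card_le_of_not_hasColumnConstantRectangle`).

If that player is Alice, her view leaves at most `2 (n + 1)` values of `y` on `D`, so `H(Y | AX) ≤
log (n + 1) + 1`, while `H(Y) ≥ n - 1` because `D` is large. The same fibers bound the cost:
covering `D` by so few pairs per view takes many views. Bob's case is symmetric. -/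

/-! ### Rectangles and the number of received strings. -/

namespace Protocol

variable {X Y Z : Type}

/-- If `x` and `x'` make Bob receive the same bits on `y`, while `y` and `y'` make Alice receive
the same bits on `x`, then Bob's answer on `y'` does not distinguish `x` from `x'`. -/
theorem output_eq_of_received_eq (π : Protocol X Y Z) {x x' : X} {y y' : Y}
    (hB : π.receivedByBob x' y = π.receivedByBob x y)
    (hA : π.receivedByAlice x y' = π.receivedByAlice x y) :
    π.output x' y' = π.output x y' := by
  induction π with
  | leaf answer => rfl
  | aliceSends message next ih =>
    simp only [receivedByBob, List.cons.injEq] at hB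
    -- Bob sees every bit of Alice, so `hB` forces `x` and `x'` into the same branch; at Bob's nodes
    -- `hA` does this for `y` and `y'`.
    obtain ⟨hm, hB⟩ := hB
    rw [hm] at hB
    simp only [output, hm]
    exact ih _ hB hA
  | bobSends message next ih =>
    simp only [receivedByAlice, List.cons.injEq] at hA
    obtain ⟨hm, hA⟩ := hA
    rw [hm] at hA
    simp only [output, hm]
    exact ih _ hB hA

end Protocol

/-- A family of strings that all start with the bit `m`, split by the value of `m`, has at most
`2 ^ (c + 1)` members if each of the two families of tails has at most `2 ^ c` members. -/
theorem card_image_cons_le {α : Type} (P : Finset α) (m : α → Bool) (g : Bool → α → List Bool)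
    (c : ℕ) (h : ∀ b, ((P.filter fun a => m a = b).image (g b)).card ≤ 2 ^ c) :
    (P.image fun a => m a :: g (m a) a).card ≤ 2 ^ (c + 1) := by
  have hsub : (P.image fun a => m a :: g (m a) a) ⊆
      (((P.filter fun a => m a = true).image (g true)).image (List.cons true)) ∪
      (((P.filter fun a => m a = false).image (g false)).image (List.cons false)) := by
    intro l hl
    obtain ⟨a, ha, rfl⟩ := Finset.mem_image.1 hl
    rw [Finset.mem_union]
    cases hm : m a
    · exact Or.inr (Finset.mem_image_of_mem _ (Finset.mem_image_of_mem _ (by simp [ha, hm])))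
    · exact Or.inl (Finset.mem_image_of_mem _ (Finset.mem_image_of_mem _ (by simp [ha, hm])))
  have h1 := Finset.card_le_card hsub
  have h2 := Finset.card_union_le
    (((P.filter fun a => m a = true).image (g true)).image (List.cons true))
    (((P.filter fun a => m a = false).image (g false)).image (List.cons false))
  have h3 := (Finset.card_image_le (s := (P.filter fun a => m a = true).image (g true))
    (f := List.cons true)).trans (h true)
  have h4 := (Finset.card_image_le (s := (P.filter fun a => m a = false).image (g false))
    (f := List.cons false)).trans (h false)
  rw [pow_succ]
  omega

namespace Protocol

variable {X Y Z : Type}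

/-- For a fixed input of Bob, at most `2 ^ c` strings of length at most `c` reach him. -/
theorem card_image_receivedByBob_le (π : Protocol X Y Z) (y : Y) (c : ℕ) (P : Finset X)
    (hP : ∀ x ∈ P, (π.receivedByBob x y).length ≤ c) :
    (P.image fun x => π.receivedByBob x y).card ≤ 2 ^ c := by
  induction π generalizing c P with
  | leaf answer =>
    calc _ ≤ ({[]} : Finset (List Bool)).card :=
          Finset.card_le_card (by intro l; simp +contextual [receivedByBob])
      _ ≤ 2 ^ c := by simpa using Nat.one_le_two_pow
  | bobSends message next ih => exact ih _ c P hP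
  | aliceSends message next ih =>
    cases c with
    -- With no bits left, no input can pass a node where Bob receives one, so `P` is empty.
    | zero =>
      have : P = ∅ := Finset.eq_empty_of_forall_notMem fun x hx => by
        simpa [receivedByBob] using hP x hx
      simp [this]
    | succ c =>
      refine card_image_cons_le P message (fun b x => (next b).receivedByBob x y) c fun b =>
        ih b c _ fun x hx => ?_
      obtain ⟨hxP, rfl⟩ := Finset.mem_filter.1 hx
      simpa [receivedByBob] using hP x hxP

/-- For a fixed input of Alice, at most `2 ^ c` strings of length at most `c` reach her. -/
theorem card_image_receivedByAlice_le (π : Protocol X Y Z) (x : X) (c : ℕ) (P : Finset Y)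
    (hP : ∀ y ∈ P, (π.receivedByAlice x y).length ≤ c) :
    (P.image fun y => π.receivedByAlice x y).card ≤ 2 ^ c := by
  induction π generalizing c P with
  | leaf answer =>
    calc _ ≤ ({[]} : Finset (List Bool)).card :=
          Finset.card_le_card (by intro l; simp +contextual [receivedByAlice])
      _ ≤ 2 ^ c := by simpa using Nat.one_le_two_pow
  | aliceSends message next ih => exact ih _ c P hP
  | bobSends message next ih =>
    cases c with
    | zero =>
      have : P = ∅ := Finset.eq_empty_of_forall_notMem fun y hy => by
        simpa [receivedByAlice] using hP y hy
      simp [this]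
    | succ c =>
      refine card_image_cons_le P message (fun b y => (next b).receivedByAlice x y) c fun b =>
        ih b c _ fun y hy => ?_
      obtain ⟨hyP, rfl⟩ := Finset.mem_filter.1 hy
      simpa [receivedByAlice] using hP y hyP

end Protocol

/-! ### Entropy under the uniform distribution on a finite set. -/

section Entropy

variable {Ω α β : Type} [Fintype Ω] [DecidableEq α] [DecidableEq β]

theorem probEq_uniformOfFinset (D : Finset Ω) (hD : D.Nonempty) (S : Ω → α) (s : α) :
    probEq (PMF.uniformOfFinset D hD) S s = ((D.filter fun w => S w = s).card : ℝ) / D.card := by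
  classical
  have h : (PMF.map S (PMF.uniformOfFinset D hD)) s
      = ((D.filter fun w => S w = s).card : ENNReal) * (D.card : ENNReal)⁻¹ := by
    rw [PMF.map_apply, tsum_fintype]
    simp only [PMF.uniformOfFinset_apply]
    rw [← nsmul_eq_mul, ← Finset.sum_const, Finset.sum_filter,
      ← Finset.sum_subset (Finset.subset_univ D) (fun w _ hw => by simp [hw])]
    exact Finset.sum_congr rfl fun w hw => by simp [hw, eq_comm]
  rw [probEq, h]
  simp [div_eq_mul_inv]

theorem probEq_uniformOfFinset_nonneg (D : Finset Ω) (hD : D.Nonempty) (S : Ω → α) (s : α) :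
    0 ≤ probEq (PMF.uniformOfFinset D hD) S s := by
  rw [probEq_uniformOfFinset]
  positivity

theorem sum_probEq_uniformOfFinset (D : Finset Ω) (hD : D.Nonempty) (S : Ω → α) :
    ∑ s ∈ Finset.univ.image S, probEq (PMF.uniformOfFinset D hD) S s = 1 := by
  simp only [probEq_uniformOfFinset]
  rw [← Finset.sum_div, ← Nat.cast_sum, ← Finset.card_eq_sum_card_fiberwise]
  · exact div_self (by exact_mod_cast hD.card_pos.ne')
  · intro w _
    simp

/-- Min-entropy bounds Shannon entropy from below: if every value of `S` has probability at most
`1 / M`, then `H(S) ≥ log M`. -/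
theorem logb_le_shannonEntropy (D : Finset Ω) (hD : D.Nonempty) (S : Ω → α) {M : ℝ} (hM : 0 < M)
    (h : ∀ s, ((D.filter fun w => S w = s).card : ℝ) * M ≤ D.card) :
    Real.logb 2 M ≤ shannonEntropy (PMF.uniformOfFinset D hD) S := by
  have hc : (0 : ℝ) < D.card := by exact_mod_cast hD.card_pos
  rw [shannonEntropy, ← Finset.sum_neg_distrib, ← one_mul (Real.logb 2 M),
    ← sum_probEq_uniformOfFinset D hD S, Finset.sum_mul]
  refine Finset.sum_le_sum fun s _ => ?_
  have h0 := probEq_uniformOfFinset_nonneg D hD S s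
  rw [← mul_neg]
  rcases h0.eq_or_lt with h0 | h0
  · simp [← h0]
  refine mul_le_mul_of_nonneg_left ?_ h0.le
  rw [← Real.logb_inv]
  refine Real.logb_le_logb_of_le (by norm_num) hM ?_
  rw [le_inv_comm₀ hM h0, probEq_uniformOfFinset, div_le_iff₀ hc, inv_mul_eq_div,
    le_div_iff₀ hM]
  exact h s

/-- A probability vector with at most `k` nonzero entries has entropy at most `log k`. -/
theorem neg_sum_mul_logb_le {ι : Type} (I : Finset ι) (q : ι → ℝ) (h0 : ∀ i ∈ I, 0 ≤ q i)
    (h1 : ∑ i ∈ I, q i = 1) (k : ℕ) (hk : (I.filter fun i => q i ≠ 0).card ≤ k) :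
    -∑ i ∈ I, q i * Real.logb 2 (q i) ≤ Real.logb 2 k := by
  classical
  set J := I.filter fun i => q i ≠ 0
  have hJ : ∑ i ∈ J, q i = 1 := by rw [← h1, Finset.sum_filter_ne_zero]
  have hJ' : ∑ i ∈ J, q i * Real.logb 2 (q i) = ∑ i ∈ I, q i * Real.logb 2 (q i) := by
    refine Finset.sum_subset (Finset.filter_subset _ _) fun i hi hiJ => ?_
    have : q i = 0 := by simpa [J, hi] using hiJ
    simp [this]
  have hne : J.Nonempty := Finset.nonempty_of_sum_ne_zero (by rw [hJ]; exact one_ne_zero)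
  have hk0 : (0 : ℝ) < k := by exact_mod_cast hne.card_pos.trans_le hk
  have hlog : 0 < Real.log 2 := Real.log_pos (by norm_num)
  -- This is `log z ≤ z - 1` at `z = 1 / (q i * k)`. Summed over the support, it bounds the entropy
  -- minus `log k` by `|J| / k - 1 ≤ 0`, in natural logarithms.
  have key : ∀ i ∈ J, -(q i * Real.log (q i)) - q i * Real.log k ≤ (k : ℝ)⁻¹ - q i := by
    intro i hi
    obtain ⟨hiI, hi0⟩ := Finset.mem_filter.1 hi
    have hq : 0 < q i := lt_of_le_of_ne (h0 i hiI) (Ne.symm hi0)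
    have hle := Real.log_le_sub_one_of_pos (x := (q i * k)⁻¹) (by positivity)
    rw [Real.log_inv, Real.log_mul hq.ne' hk0.ne'] at hle
    have := mul_le_mul_of_nonneg_left hle hq.le
    have he : q i * ((q i * k)⁻¹ - 1) = (k : ℝ)⁻¹ - q i := by field_simp
    linarith
  have hsum := Finset.sum_le_sum key
  rw [Finset.sum_sub_distrib, Finset.sum_sub_distrib, ← Finset.sum_mul, hJ, Finset.sum_const,
    nsmul_eq_mul, Finset.sum_neg_distrib] at hsum
  have hle : (J.card : ℝ) * (k : ℝ)⁻¹ ≤ 1 := by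
    rw [← div_eq_mul_inv, div_le_one hk0]
    exact_mod_cast hk
  rw [← hJ']
  simp only [Real.logb, ← mul_div_assoc]
  rw [← Finset.sum_div, ← neg_div]
  gcongr
  linarith

/-- If each value of `T` leaves at most `k` possible values of `S`, then `H(S | T) ≤ log k`. -/
theorem condShannonEntropy_le_logb (D : Finset Ω) (hD : D.Nonempty) (S : Ω → α) (T : Ω → β)
    (k : ℕ) (h : ∀ t, ((D.filter fun w => T w = t).image S).card ≤ k) :
    condShannonEntropy (PMF.uniformOfFinset D hD) S T ≤ Real.logb 2 k := by
  have hc : (0 : ℝ) < D.card := by exact_mod_cast hD.card_pos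
  rw [condShannonEntropy, ← one_mul (Real.logb 2 (k : ℝ)), ← sum_probEq_uniformOfFinset D hD T,
    Finset.sum_mul]
  refine Finset.sum_le_sum fun t _ => ?_
  have h0 := probEq_uniformOfFinset_nonneg D hD T t
  rcases h0.eq_or_lt with h0 | h0
  · simp [← h0]
  refine mul_le_mul_of_nonneg_left ?_ h0.le
  have hpair : ∀ s, condProbEq (PMF.uniformOfFinset D hD) S T s t =
      (((D.filter fun w => T w = t).filter fun w => S w = s).card : ℝ) /
        (D.filter fun w => T w = t).card := by
    intro s
    rw [condProbEq, probEq_uniformOfFinset, probEq_uniformOfFinset,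
      div_div_div_cancel_right₀ hc.ne', Finset.filter_filter]
    congr 4
    ext w
    simp [and_comm]
  have ht : (0 : ℝ) < (D.filter fun w => T w = t).card := by
    rw [probEq_uniformOfFinset] at h0
    exact (div_pos_iff_of_pos_right hc).1 h0
  refine neg_sum_mul_logb_le _ _ (fun s _ => ?_) ?_ k (le_trans (Finset.card_le_card ?_) (h t))
  · rw [hpair]
    positivity
  · simp only [hpair]
    rw [← Finset.sum_div, ← Nat.cast_sum, ← Finset.card_eq_sum_card_fiberwise]
    · exact div_self ht.ne'
    · intro w _
      simp
  · intro s hs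
    have hs := (Finset.mem_filter.1 hs).2
    rw [hpair] at hs
    have hpos : ((D.filter fun w => T w = t).filter fun w => S w = s).card ≠ 0 := by
      intro h'
      simp [h'] at hs
    obtain ⟨w, hw⟩ := Finset.card_ne_zero.1 hpos
    obtain ⟨hwT, rfl⟩ := Finset.mem_filter.1 hw
    exact Finset.mem_image_of_mem _ hwT

theorem logb_sub_logb_le_mutualInformation (D : Finset Ω) (hD : D.Nonempty) (S : Ω → α)
    (T : Ω → β) {M : ℝ} (hM : 0 < M) (k : ℕ)
    (hS : ∀ s, ((D.filter fun w => S w = s).card : ℝ) * M ≤ D.card)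
    (hT : ∀ t, ((D.filter fun w => T w = t).image S).card ≤ k) :
    Real.logb 2 M - Real.logb 2 k ≤ mutualInformation (PMF.uniformOfFinset D hD) S T :=
  sub_le_sub (logb_le_shannonEntropy D hD S hM hS) (condShannonEntropy_le_logb D hD S T k hT)

end Entropy

/-! ### From fiber sizes to information and cost. -/

/-- If `D` contains at least half of all pairs of `n`-bit strings and `S` takes each
value at most `2 ^ n` times on `D`, while each value of `T` leaves at most `2 (n + 1)` values of
`S`, then `I(S : T) ≥ n - log (n + 1) - 2`. -/
theorem le_mutualInformation_of_fibers {n : ℕ} {α β : Type} [DecidableEq α] [DecidableEq β]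
    (D : Finset (BitString n × BitString n)) (hD : D.Nonempty)
    (hcard : Fintype.card (BitString n × BitString n) ≤ 2 * D.card)
    (S : BitString n × BitString n → α) (T : BitString n × BitString n → β)
    (hS : ∀ s, (D.filter fun w => S w = s).card ≤ 2 ^ n)
    (hT : ∀ t, ((D.filter fun w => T w = t).image S).card ≤ 2 * (n + 1)) :
    (n : ℝ) - Real.logb 2 ((n : ℝ) + 1) - 2 ≤ mutualInformation (PMF.uniformOfFinset D hD) S T := by
  have h2 : (2 : ℝ) ^ n * 2 ^ n ≤ 2 * D.card := by
    have : 2 ^ n * 2 ^ n ≤ 2 * D.card := by simpa [BitString] using hcard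
    exact_mod_cast this
  -- A value of `S` has probability at most `2 ^ n / |D| ≤ 2 / 2 ^ n`, hence this `M`. One bit is
  -- lost here and one in `log (2 (n + 1))`.
  have h := logb_sub_logb_le_mutualInformation D hD S T (M := 2 ^ n / 2) (by positivity)
    (2 * (n + 1)) (fun s => ?_) hT
  · refine le_trans (le_of_eq ?_) h
    push_cast
    rw [Real.logb_div (by positivity) (by norm_num), Real.logb_mul (by norm_num) (by positivity),
      Real.logb_pow, Real.logb_self_eq_one (by norm_num)]
    ring
  · have hs : ((D.filter fun w => S w = s).card : ℝ) ≤ 2 ^ n := by exact_mod_cast hS s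
    have := mul_le_mul_of_nonneg_right hs (by positivity : (0 : ℝ) ≤ 2 ^ n / 2)
    linarith

/-- If `D` contains at least half of all pairs of `n`-bit strings, and for each of the `2 ^ n`
values of `V` the random variable `R` takes at most `2 ^ c` values, each pair of values of `R` and
`V` being taken at most `2 (n + 1)` times on `D`, then `c ≥ n - log (n + 1) - 2`. -/
theorem le_cost_of_fibers {n c : ℕ} {β : Type} [DecidableEq β]
    (D : Finset (BitString n × BitString n))
    (hcard : Fintype.card (BitString n × BitString n) ≤ 2 * D.card)
    (V : BitString n × BitString n → BitString n) (R : BitString n × BitString n → β)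
    (hR : ∀ v, ((D.filter fun w => V w = v).image R).card ≤ 2 ^ c)
    (hfib : ∀ v r, ((D.filter fun w => V w = v).filter fun w => R w = r).card ≤ 2 * (n + 1)) :
    (n : ℝ) - Real.logb 2 ((n : ℝ) + 1) - 2 ≤ c := by
  have h1 : D.card ≤ 2 ^ n * (2 ^ c * (2 * (n + 1))) := by
    have h2 : D.card ≤ (2 ^ c * (2 * (n + 1))) * (Finset.univ : Finset (BitString n)).card := by
      refine Finset.card_le_mul_card_image_of_maps_to (f := V) (by simp) _ fun v _ => ?_
      refine (Finset.card_le_mul_card_image _ (2 * (n + 1)) fun r _ => hfib v r).trans ?_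
      rw [mul_comm]
      exact Nat.mul_le_mul_right _ (hR v)
    rw [mul_comm]
    simpa [BitString] using h2
  -- The `4` combines the density of `D` with the `2` in the fiber size; it becomes the `2`
  -- subtracted in the conclusion.
  have h3 : 2 ^ n * 2 ^ n ≤ 2 ^ n * (2 ^ c * 4 * (n + 1)) := by
    have : 2 ^ n * 2 ^ n ≤ 2 * D.card := by simpa [BitString] using hcard
    calc _ ≤ 2 * D.card := this
      _ ≤ 2 * (2 ^ n * (2 ^ c * (2 * (n + 1)))) := by gcongr
      _ = _ := by ring
  have h4 : (2 : ℝ) ^ n ≤ 2 ^ c * 2 ^ 2 * ((n : ℝ) + 1) := by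
    have : 2 ^ n ≤ 2 ^ c * 2 ^ 2 * (n + 1) := Nat.le_of_mul_le_mul_left h3 (by positivity)
    exact_mod_cast this
  have h5 := Real.logb_le_logb_of_le (b := 2) (by norm_num) (by positivity) h4
  rw [Real.logb_mul (by positivity) (by positivity), Real.logb_mul (by positivity) (by positivity),
    Real.logb_pow, Real.logb_pow, Real.logb_pow, Real.logb_self_eq_one (by norm_num)] at h5
  push_cast at h5
  linarith

/-! ### Counting functions with a column-constant rectangle. -/

section Counting

variable {X Y : Type}

/-- There is an `s × t` combinatorial rectangle on which `f x y` does not depend on `x`. -/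
def HasColumnConstantRectangle (f : X → Y → Bool) (s t : ℕ) : Prop :=
  ∃ (u : Fin s → X) (v : Fin t → Y), u.Injective ∧ v.Injective ∧
    ∀ i i' j, f (u i) (v j) = f (u i') (v j)

/-- Row `u 0` determines the other `s` rows of the rectangle, so `f` is known from its values off
those `s * t` cells. -/
theorem card_filter_columnConstant_mul_le [Fintype X] [Fintype Y] [DecidableEq X]
    [DecidableEq Y] {s t : ℕ} (u : Fin (s + 1) → X) (v : Fin t → Y)
    (hu : u.Injective) (hv : v.Injective) :
    (Finset.univ.filter fun f : X → Y → Bool =>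
        ∀ i i' j, f (u i) (v j) = f (u i') (v j)).card * 2 ^ (s * t) ≤
      Fintype.card (X → Y → Bool) := by
  set g : Fin s × Fin t → X × Y := fun p => (u p.1.succ, v p.2)
  have hg : g.Injective := by
    rintro ⟨i, j⟩ ⟨i', j'⟩ h
    simp only [g, Prod.mk.injEq] at h
    rw [Fin.succ_injective _ (hu h.1), hv h.2]
  set K : Finset (X × Y) := Finset.univ.image g
  have hK : K.card = s * t := by
    rw [Finset.card_image_of_injective _ hg]
    simp
  have hle : Fintype.card {f : X → Y → Bool // ∀ i i' j, f (u i) (v j) = f (u i') (v j)} ≤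
      Fintype.card ({p : X × Y // p ∉ K} → Bool) := by
    refine Fintype.card_le_of_injective (fun f p => f.1 p.1.1 p.1.2) ?_
    rintro ⟨f, hf⟩ ⟨f', hf'⟩ h
    have hout : ∀ x y, (x, y) ∉ K → f x y = f' x y := fun x y hxy => congrFun h ⟨(x, y), hxy⟩
    refine Subtype.ext (funext fun x => funext fun y => ?_)
    by_cases hxy : (x, y) ∈ K
    · obtain ⟨⟨i, j⟩, -, hij⟩ := Finset.mem_image.1 hxy
      simp only [g, Prod.mk.injEq] at hij
      obtain ⟨rfl, rfl⟩ := hij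
      change f _ _ = f' _ _
      -- Both values are moved to row `u 0`, which lies outside `K`.
      rw [hf _ 0, hf' _ 0]
      refine hout _ _ fun h0 => ?_
      obtain ⟨⟨i', j'⟩, -, hij'⟩ := Finset.mem_image.1 h0
      simp only [g, Prod.mk.injEq] at hij'
      exact Fin.succ_ne_zero _ (hu hij'.1)
    · exact hout x y hxy
  have hcompl : Fintype.card {p : X × Y // p ∉ K} = Fintype.card X * Fintype.card Y - s * t := by
    rw [Fintype.card_subtype_compl, Fintype.card_prod, Fintype.card_coe, hK]
  have hst : s * t ≤ Fintype.card X * Fintype.card Y := by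
    rw [← hK, ← Fintype.card_prod]
    exact Finset.card_le_univ K
  rw [Fintype.card_subtype, Fintype.card_fun, hcompl, Fintype.card_bool] at hle
  calc _ ≤ 2 ^ (Fintype.card X * Fintype.card Y - s * t) * 2 ^ (s * t) := by gcongr
    _ = 2 ^ (Fintype.card X * Fintype.card Y) := by rw [← pow_add, Nat.sub_add_cancel hst]
    _ = Fintype.card (X → Y → Bool) := by
      rw [Fintype.card_fun, Fintype.card_fun, Fintype.card_bool, ← pow_mul, mul_comm]

/-- The union bound over all `(s + 1) × t` rectangles. -/
theorem ncard_hasColumnConstantRectangle_mul_le [Fintype X] [Fintype Y] [DecidableEq X]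
    [DecidableEq Y] (s t : ℕ) :
    {f : X → Y → Bool | HasColumnConstantRectangle f (s + 1) t}.ncard * 2 ^ (s * t) ≤
      Fintype.card X ^ (s + 1) * Fintype.card Y ^ t * Fintype.card (X → Y → Bool) := by
  classical
  set I : Finset ((Fin (s + 1) → X) × (Fin t → Y)) :=
    Finset.univ.filter fun p => p.1.Injective ∧ p.2.Injective
  set F : (Fin (s + 1) → X) × (Fin t → Y) → Finset (X → Y → Bool) := fun p =>
    Finset.univ.filter fun f => ∀ i i' j, f (p.1 i) (p.2 j) = f (p.1 i') (p.2 j)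
  have hsub : {f : X → Y → Bool | HasColumnConstantRectangle f (s + 1) t} =
      (I.biUnion F : Finset (X → Y → Bool)) := by
    ext f
    simp [HasColumnConstantRectangle, I, F, and_assoc]
  have hI : I.card ≤ Fintype.card X ^ (s + 1) * Fintype.card Y ^ t := by
    refine (Finset.card_le_univ I).trans (le_of_eq ?_)
    simp
  rw [hsub, Set.ncard_coe_finset]
  calc _ ≤ (∑ p ∈ I, (F p).card) * 2 ^ (s * t) := by
        gcongr
        exact Finset.card_biUnion_le
    _ = ∑ p ∈ I, (F p).card * 2 ^ (s * t) := Finset.sum_mul _ _ _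
    _ ≤ ∑ _p ∈ I, Fintype.card (X → Y → Bool) := by
        refine Finset.sum_le_sum fun p hp => ?_
        obtain ⟨-, hu, hv⟩ := Finset.mem_filter.1 hp
        exact card_filter_columnConstant_mul_le p.1 p.2 hu hv
    _ = I.card * Fintype.card (X → Y → Bool) := by simp
    _ ≤ _ := by gcongr

end Counting

/-- All but a `2 ^ (-n)` fraction of the functions have no column-constant rectangle of side
`2 n + 3`. -/
theorem ncard_hasColumnConstantRectangle_bitString_le (n : ℕ) :
    {f : BitString n → BitString n → Bool |
        HasColumnConstantRectangle f (2 * n + 3) (2 * n + 3)}.ncard * 2 ^ n ≤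
      Fintype.card (BitString n → BitString n → Bool) := by
  have h := ncard_hasColumnConstantRectangle_mul_le (X := BitString n) (Y := BitString n)
    (2 * n + 2) (2 * n + 3)
  have hN : Fintype.card (BitString n) = 2 ^ n := by simp [BitString]
  rw [hN, ← pow_mul, ← pow_add] at h
  -- The bracket is the exponent for the choices of `u` and `v`. Of the surplus `4 n + 6`, the `n`
  -- is the claimed saving and the rest is discarded.
  have he : (2 * n + 2) * (2 * n + 3) =
      (n * (2 * n + 2 + 1) + n * (2 * n + 2 + 1)) + n + (3 * n + 6) := by ring
  rw [he, pow_add, pow_add] at h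
  have hpos : 0 < 2 ^ (n * (2 * n + 2 + 1) + n * (2 * n + 2 + 1)) := by positivity
  refine Nat.le_of_mul_le_mul_left (le_trans ?_ h) hpos
  have h1 : 1 ≤ 2 ^ (3 * n + 6) := Nat.one_le_two_pow
  calc _ = {f : BitString n → BitString n → Bool |
        HasColumnConstantRectangle f (2 * n + 3) (2 * n + 3)}.ncard *
        (2 ^ (n * (2 * n + 2 + 1) + n * (2 * n + 2 + 1)) * 2 ^ n * 1) := by ring
    _ ≤ _ := by gcongr

/-! ### Small fibers of one player's view and their consequences. -/

/-- Either most inputs lie in small fibers of Bob's view or most lie in small fibers of Alice's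
view, when the protocol computes a function without large column-constant rectangles. -/
theorem Protocol.half_card_le_of_not_hasColumnConstantRectangle {X Y : Type} [Fintype X]
    [Fintype Y] [DecidableEq X] [DecidableEq Y] {f : X → Y → Bool} (π : Protocol X Y Bool)
    (hπ : π.Computes f) (k : ℕ) (hf : ¬ HasColumnConstantRectangle f (k + 1) (k + 1)) :
    Fintype.card (X × Y) ≤ 2 * (Finset.univ.filter fun w : X × Y =>
        (Finset.univ.filter fun y' =>
          π.receivedByAlice w.1 y' = π.receivedByAlice w.1 w.2).card ≤ k).card ∨
    Fintype.card (X × Y) ≤ 2 * (Finset.univ.filter fun w : X × Y =>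
        (Finset.univ.filter fun x' =>
          π.receivedByBob x' w.2 = π.receivedByBob w.1 w.2).card ≤ k).card := by
  set D₁ := Finset.univ.filter fun w : X × Y =>
    (Finset.univ.filter fun y' =>
      π.receivedByAlice w.1 y' = π.receivedByAlice w.1 w.2).card ≤ k
  set D₂ := Finset.univ.filter fun w : X × Y =>
    (Finset.univ.filter fun x' =>
      π.receivedByBob x' w.2 = π.receivedByBob w.1 w.2).card ≤ k
  have hcover : (Finset.univ : Finset (X × Y)) ⊆ D₁ ∪ D₂ := by
    rintro ⟨x, y⟩ -
    by_contra hw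
    simp only [D₁, D₂, Finset.mem_union, Finset.mem_filter, Finset.mem_univ, true_and, not_or,
      not_le] at hw
    obtain ⟨hA, hB⟩ := hw
    obtain ⟨T, hT, hTc⟩ := Finset.exists_subset_card_eq hA
    obtain ⟨S, hS, hSc⟩ := Finset.exists_subset_card_eq hB
    refine hf ⟨fun i => (S.equivFinOfCardEq hSc).symm i, fun j => (T.equivFinOfCardEq hTc).symm j,
      Subtype.val_injective.comp (Equiv.injective _),
      Subtype.val_injective.comp (Equiv.injective _), ?_⟩
    -- All rows are compared with row `x`, which need not belong to `S` after trimming to `k + 1`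
    -- elements.
    have key : ∀ x' ∈ S, ∀ y' ∈ T, f x' y' = f x y' := by
      intro x' hx' y' hy'
      rw [← hπ, ← hπ]
      exact π.output_eq_of_received_eq (Finset.mem_filter.1 (hS hx')).2
        (Finset.mem_filter.1 (hT hy')).2
    intro i i' j
    rw [key _ (Subtype.prop _) _ (Subtype.prop _), key _ (Subtype.prop _) _ (Subtype.prop _)]
  have h1 := Finset.card_le_card hcover
  have h2 := Finset.card_union_le D₁ D₂
  rw [Finset.card_univ] at h1
  omega

theorem Finset.card_filter_fst_eq_le {X Y : Type} [Fintype Y] [DecidableEq X]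
    (D : Finset (X × Y)) (x : X) : (D.filter fun w => w.1 = x).card ≤ Fintype.card Y := by
  rw [← Finset.card_univ]
  refine Finset.card_le_card_of_injOn Prod.snd (by simp) fun w hw w' hw' h => ?_
  simp only [Finset.coe_filter, Set.mem_ofPred_eq] at hw hw'
  exact Prod.ext (hw.2.trans hw'.2.symm) h

theorem Finset.card_filter_snd_eq_le {X Y : Type} [Fintype X] [DecidableEq Y]
    (D : Finset (X × Y)) (y : Y) : (D.filter fun w => w.2 = y).card ≤ Fintype.card X := by
  rw [← Finset.card_univ]
  refine Finset.card_le_card_of_injOn Prod.fst (by simp) fun w hw w' hw' h => ?_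
  simp only [Finset.coe_filter, Set.mem_ofPred_eq] at hw hw'
  exact Prod.ext h (hw.2.trans hw'.2.symm)

/-- The small fibers serve twice: few pairs per view force many received strings, hence a long one,
and few `y` per view make `H(Y | AX)` small. -/
theorem Protocol.le_costAlice_and_le_infoAlice {n : ℕ}
    (π : Protocol (BitString n) (BitString n) Bool) (D : Finset (BitString n × BitString n))
    (hD : D.Nonempty) (hcard : Fintype.card (BitString n × BitString n) ≤ 2 * D.card)
    (hfib : ∀ w ∈ D, (Finset.univ.filter fun y' =>
      π.receivedByAlice w.1 y' = π.receivedByAlice w.1 w.2).card ≤ 2 * (n + 1)) :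
    (n : ℝ) - Real.logb 2 ((n : ℝ) + 1) - 2 ≤ (π.costAlice : ℝ) ∧
      (n : ℝ) - Real.logb 2 ((n : ℝ) + 1) - 2 ≤ infoAlice π (PMF.uniformOfFinset D hD) := by
  have hfib' : ∀ x a, ((D.filter fun w => w.1 = x ∧ π.receivedByAlice w.1 w.2 = a).image
      Prod.snd).card ≤ 2 * (n + 1) := by
    intro x a
    -- `hfib` speaks only of views occurring on `D`; any other view leaves no `y` at all.
    rcases (D.filter fun w => w.1 = x ∧ π.receivedByAlice w.1 w.2 = a).eq_empty_or_nonempty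
      with h | ⟨w, hw⟩
    · simp [h]
    obtain ⟨hwD, rfl, rfl⟩ := Finset.mem_filter.1 hw
    refine (Finset.card_le_card ?_).trans (hfib w hwD)
    intro y' hy'
    obtain ⟨w', hw', rfl⟩ := Finset.mem_image.1 hy'
    obtain ⟨-, h1, h2⟩ := Finset.mem_filter.1 hw'
    rw [Finset.mem_filter, ← h2, h1]
    exact ⟨Finset.mem_univ _, rfl⟩
  constructor
  · refine le_cost_of_fibers D hcard Prod.fst (fun w => π.receivedByAlice w.1 w.2) ?_ ?_
    · intro x
      refine le_trans (Finset.card_le_card ?_)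
        (π.card_image_receivedByAlice_le x π.costAlice Finset.univ fun y _ =>
          Finset.le_sup (f := fun w : BitString n × BitString n =>
            (π.receivedByAlice w.1 w.2).length) (Finset.mem_univ (x, y)))
      intro a ha
      obtain ⟨w, hw, rfl⟩ := Finset.mem_image.1 ha
      obtain ⟨-, rfl⟩ := Finset.mem_filter.1 hw
      exact Finset.mem_image_of_mem (fun y => π.receivedByAlice w.1 y) (Finset.mem_univ w.2)
    · intro x a
      rw [Finset.filter_filter]
      -- With the first coordinate fixed, counting pairs is counting values of `y`.
      refine le_trans (le_of_eq (Finset.card_image_of_injOn ?_).symm) (hfib' x a)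
      intro w hw w' hw' h
      simp only [Finset.coe_filter, Set.mem_ofPred_eq] at hw hw'
      exact Prod.ext (hw.2.1.trans hw'.2.1.symm) h
  · refine le_mutualInformation_of_fibers D hD hcard _ _ (fun y => ?_) fun t => ?_
    · simpa [BitString] using D.card_filter_snd_eq_le y
    · refine le_trans (le_of_eq ?_) (hfib' t.2 t.1)
      congr 2
      ext w
      simp [Prod.ext_iff, and_comm]

theorem Protocol.le_costBob_and_le_infoBob {n : ℕ}
    (π : Protocol (BitString n) (BitString n) Bool) (D : Finset (BitString n × BitString n))
    (hD : D.Nonempty) (hcard : Fintype.card (BitString n × BitString n) ≤ 2 * D.card)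
    (hfib : ∀ w ∈ D, (Finset.univ.filter fun x' =>
      π.receivedByBob x' w.2 = π.receivedByBob w.1 w.2).card ≤ 2 * (n + 1)) :
    (n : ℝ) - Real.logb 2 ((n : ℝ) + 1) - 2 ≤ (π.costBob : ℝ) ∧
      (n : ℝ) - Real.logb 2 ((n : ℝ) + 1) - 2 ≤ infoBob π (PMF.uniformOfFinset D hD) := by
  have hfib' : ∀ y b, ((D.filter fun w => w.2 = y ∧ π.receivedByBob w.1 w.2 = b).image
      Prod.fst).card ≤ 2 * (n + 1) := by
    intro y b
    rcases (D.filter fun w => w.2 = y ∧ π.receivedByBob w.1 w.2 = b).eq_empty_or_nonempty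
      with h | ⟨w, hw⟩
    · simp [h]
    obtain ⟨hwD, rfl, rfl⟩ := Finset.mem_filter.1 hw
    refine (Finset.card_le_card ?_).trans (hfib w hwD)
    intro x' hx'
    obtain ⟨w', hw', rfl⟩ := Finset.mem_image.1 hx'
    obtain ⟨-, h1, h2⟩ := Finset.mem_filter.1 hw'
    rw [Finset.mem_filter, ← h2, h1]
    exact ⟨Finset.mem_univ _, rfl⟩
  constructor
  · refine le_cost_of_fibers D hcard Prod.snd (fun w => π.receivedByBob w.1 w.2) ?_ ?_
    · intro y
      refine le_trans (Finset.card_le_card ?_)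
        (π.card_image_receivedByBob_le y π.costBob Finset.univ fun x _ =>
          Finset.le_sup (f := fun w : BitString n × BitString n =>
            (π.receivedByBob w.1 w.2).length) (Finset.mem_univ (x, y)))
      intro b hb
      obtain ⟨w, hw, rfl⟩ := Finset.mem_image.1 hb
      obtain ⟨-, rfl⟩ := Finset.mem_filter.1 hw
      exact Finset.mem_image_of_mem (fun x => π.receivedByBob x w.2) (Finset.mem_univ w.1)
    · intro y b
      rw [Finset.filter_filter]
      refine le_trans (le_of_eq (Finset.card_image_of_injOn ?_).symm) (hfib' y b)
      intro w hw w' hw' h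
      simp only [Finset.coe_filter, Set.mem_ofPred_eq] at hw hw'
      exact Prod.ext h (hw.2.1.trans hw'.2.1.symm)
  · refine le_mutualInformation_of_fibers D hD hcard _ _ (fun x => ?_) fun t => ?_
    · simpa [BitString] using D.card_filter_fst_eq_le x
    · refine le_trans (le_of_eq ?_) (hfib' t.2 t.1)
      congr 2
      ext w
      simp [Prod.ext_iff, and_comm]

/-! ### Passage to the limit and conclusion. -/

/-- If at most a `2 ^ (-n)` fraction of a finite type lies outside `G n`, the density of `G n`
tends to `1`. -/
theorem tendsto_ncard_div_card_one {α : ℕ → Type} [∀ n, Fintype (α n)] [∀ n, Nonempty (α n)]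
    (G B : ∀ n, Set (α n)) (hGB : ∀ n, (G n)ᶜ ⊆ B n)
    (hB : ∀ n, (B n).ncard * 2 ^ n ≤ Fintype.card (α n)) :
    Tendsto (fun n => ((G n).ncard : ℝ) / (Fintype.card (α n) : ℝ)) atTop (𝓝 1) := by
  have hlim : Tendsto (fun n : ℕ => 1 - ((1 : ℝ) / 2) ^ n) atTop (𝓝 1) := by
    simpa using (tendsto_pow_atTop_nhds_zero_of_lt_one (r := (1 : ℝ) / 2) (by norm_num)
      (by norm_num)).const_sub 1
  have hadd : ∀ n, (G n).ncard + (G n)ᶜ.ncard = Fintype.card (α n) := fun n => by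
    rw [Set.ncard_add_ncard_compl, Nat.card_eq_fintype_card]
  have hpos : ∀ n, (0 : ℝ) < Fintype.card (α n) := fun n => by exact_mod_cast Fintype.card_pos
  refine tendsto_of_tendsto_of_tendsto_of_le_of_le hlim tendsto_const_nhds (fun n => ?_) fun n => ?_
  · have h1 : (G n)ᶜ.ncard * 2 ^ n ≤ Fintype.card (α n) :=
      (Nat.mul_le_mul_right _ (Set.ncard_le_ncard (hGB n) (Set.toFinite _))).trans (hB n)
    have h2 : ((G n)ᶜ.ncard : ℝ) * 2 ^ n ≤ Fintype.card (α n) := by exact_mod_cast h1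
    have h3 : ((G n).ncard : ℝ) + (G n)ᶜ.ncard = Fintype.card (α n) := by exact_mod_cast hadd n
    change 1 - ((1 : ℝ) / 2) ^ n ≤ _
    rw [le_div_iff₀ (hpos n), one_div, inv_pow, sub_mul, one_mul, inv_mul_eq_div]
    have h4 : ((G n)ᶜ.ncard : ℝ) ≤ Fintype.card (α n) / 2 ^ n := by
      rwa [le_div_iff₀ (by positivity)]
    linarith
  · refine (div_le_one (hpos n)).2 ?_
    exact_mod_cast (Nat.le_add_right _ _).trans (hadd n).le

theorem lemma2 :
    Tendsto
      (fun n : ℕ =>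
        (Set.ncard {f : BitString n → BitString n → Bool |
          ∀ π : Protocol (BitString n) (BitString n) Bool, π.Computes f →
            (((n : ℝ) - Real.logb 2 ((n : ℝ) + 1) - 2 ≤ (π.costAlice : ℝ) ∧
              ∃ (D : Finset (BitString n × BitString n)) (hD : D.Nonempty),
                Fintype.card (BitString n × BitString n) ≤ 2 * D.card ∧
                (n : ℝ) - Real.logb 2 ((n : ℝ) + 1) - 3
                  ≤ infoAlice π (PMF.uniformOfFinset D hD)) ∨
             ((n : ℝ) - Real.logb 2 ((n : ℝ) + 1) - 2 ≤ (π.costBob : ℝ) ∧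
              ∃ (D : Finset (BitString n × BitString n)) (hD : D.Nonempty),
                Fintype.card (BitString n × BitString n) ≤ 2 * D.card ∧
                (n : ℝ) - Real.logb 2 ((n : ℝ) + 1) - 3
                  ≤ infoBob π (PMF.uniformOfFinset D hD)))} : ℝ)
          / (Fintype.card (BitString n → BitString n → Bool) : ℝ))
      atTop (𝓝 1) := by
  refine tendsto_ncard_div_card_one _ (fun n => {f : BitString n → BitString n → Bool |
    HasColumnConstantRectangle f (2 * n + 3) (2 * n + 3)}) (fun n => ?_)
    ncard_hasColumnConstantRectangle_bitString_le
  rw [Set.compl_subset_comm]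
  intro f hf π hπ
  have hne : ∀ D : Finset (BitString n × BitString n),
      Fintype.card (BitString n × BitString n) ≤ 2 * D.card → D.Nonempty := by
    intro D hD
    have : 0 < Fintype.card (BitString n × BitString n) := Fintype.card_pos
    exact Finset.card_pos.1 (by omega)
  -- The side `2 * n + 3` is `k + 1` for `k = 2 * (n + 1)`. The information bounds obtained are one
  -- bit stronger than required.
  rcases π.half_card_le_of_not_hasColumnConstantRectangle hπ (2 * (n + 1)) hf with h | h
  · obtain ⟨h1, h2⟩ := π.le_costAlice_and_le_infoAlice _ (hne _ h) h
      fun w hw => (Finset.mem_filter.1 hw).2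
    exact Or.inl ⟨h1, _, hne _ h, h, by linarith⟩
  · obtain ⟨h1, h2⟩ := π.le_costBob_and_le_infoBob _ (hne _ h) h
      fun w hw => (Finset.mem_filter.1 hw).2
    exact Or.inr ⟨h1, _, hne _ h, h, by linarith⟩
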